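/- **Setting.** Let $\mathbf V$ be a finite set of variables with finite domains and $\mathcal G$ a causal diagram over $\mathbf V$ (an acyclic graph with directed and bidirected edges). A structural causal model (SCM) has mutually independent exogenous variables $\mathbf U$ and a mechanism $v\leftarrow f_V(pa_V,u_V)$ for each $V\in\mathbf V$. It conforms to $\mathcal G$ if the endogenous arguments of each $f_V$ are parents of $V$ in $\mathcal G$ and any two variables sharing an exogenous variable are joined by a bidirected edge. $P_{\mathbf x}(\mathbf y)$ is the probability of $\mathbf Y=\mathbf y$ after $\mathbf X$ is set to $\mathbf x$. There are a target domain $\pi^*$ and source domains $\Pi=\{\pi^i\}$, with discrepancies $\boldsymbol\Delta=\{\Delta^i\}$, $\Delta^i\subseteq\mathbf V$. A collection of SCMs, one per domain, *induces* the collective selection diagram $\mathcal G^{\boldsymbol\Delta}$ ($\mathcal G$ with a selection variable $S_V\to V$ added for each $V\in\bigcup_i\Delta^i$) if all conform to $\mathcal G$ and, for $V\notin\Delta^i$, the mechanism of $V$ and the laws of its exogenous arguments are the same in $\pi^i$ and $\pi^*$. $\mathbf S^i$ is the set of the $S_V$, $V\in\Delta^i$. $\mathbb Z=\{\mathbb Z^i\}$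 specifies the sets $\mathbf Z\in\mathbb Z^i$ on which experiments were made in $\pi^i$; the available distributions are $\mathcal P^\Pi_{\mathbb Z}=\{P^i_{\mathbf z}: \mathbf Z\in\mathbb Z^i,\ \mathbf z\in\Omega_{\mathbf Z}\}$, and are assumed strictly positive. $\mathtt{An}(\mathbf Y)_{\mathcal G}$ are the ancestors of $\mathbf Y$ ($\mathbf Y$ included), $\mathcal G_{\overline{\mathbf X}}$ is $\mathcal G$ without the edges having an arrowhead at $\mathbf X$, and $\mathsf{cc}_{\mathcal G}$ is the set of maximal c-components (classes of vertices connected by bidirected edges). **Algorithm.** Both procedures yield expressions in the available distributions. $\mathbf V$ denotes the vertices of the current graph. Values not determined by the query ($\mathbf z\setminus\mathbf V$, and the values of $\mathbf V'$ in step 3) may be fixed arbitrarily. $\mathrm{paTR}(\mathbf y,\mathbf x,\mathcal G,\boldsymbol\Delta,\mathsf{type})$, $\mathsf{type}\in\{\ell,u\}$: 1. For any $i$ and $\mathbf Z\in\mathbb Z^i$ with $\mathbf X=\mathbf Z\cap\mathbf V$ and $\mathbf S^i$ d-separated from $\mathbf Y$ in $\mathcal G^{\boldsymbol\Delta}\setminus\mathbf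 X$: yield $P^i_{\mathbf z\setminus\mathbf V,\ \mathbf x\cap\mathbf Z}(\mathbf y)$. In addition, the first applicable one of steps 2–5 is executed: 2. If $\mathbf V':=\mathbf V\setminus\mathtt{An}(\mathbf Y)_{\mathcal G}\ne\emptyset$: yield $\mathrm{paTR}(\mathbf y,\mathbf x\setminus\mathbf V',\mathcal G\setminus\mathbf V',\{\Delta^i\setminus\mathbf V'\},\mathsf{type})$. 3. If $\mathbf V':=(\mathbf V\setminus\mathbf X)\setminus\mathtt{An}(\mathbf Y)_{\mathcal G_{\overline{\mathbf X}}}\neq\emptyset$: yield $\mathrm{paTR}(\mathbf y,\mathbf x\cup\mathbf v',\mathcal G,\boldsymbol\Delta,\mathsf{type})$. 4. If $|\mathsf{cc}_{\mathcal G\setminus\mathbf X}|>1$: yield $\sum_{\mathbf v\setminus(\mathbf y\cup\mathbf x)}\prod_{\mathbf C\in\mathsf{cc}_{\mathcal G\setminus\mathbf X}}\mathrm{paTR}(\mathbf c,\mathbf v\setminus\mathbf c,\mathcal G,\boldsymbol\Delta,\mathsf{type})$ (for every choice of one expression per factor). 5. For every $i$ with $\Delta^i\cap(\mathbf V\setminus\mathbf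 X)=\emptyset$ and every $\mathbf Z\in\mathbb Z^i$ with $\mathbf Z\cap\mathbf V\subseteq\mathbf X$: yield $\mathrm{paID}(\mathbf y,\mathbf x\setminus\mathbf Z,P^i_{\mathbf z\setminus\mathbf V,\ \mathbf x\cap\mathbf Z},\mathcal G\setminus(\mathbf Z\cap\mathbf X),\mathsf{type})$. $\mathrm{paID}(\mathbf y,\mathbf x,P,\mathcal G,\mathsf{type})$, with $\{\mathbf C\}=\mathsf{cc}_{\mathcal G\setminus\mathbf X}$ and a topological order $\pi$ of $\mathcal G$ in which $\mathbf v_\pi^{(i-1)}$ are the predecessors of $V_i$; the first applicable case is executed: 1. $\mathbf X=\emptyset$: yield $\sum_{\mathbf v\setminus\mathbf y}P(\mathbf v)$. 2. $\mathbf V\ne\mathbf A:=\mathtt{An}(\mathbf Y)_{\mathcal G}$: yield $\mathrm{paID}(\mathbf y,\mathbf x\cap\mathbf A,\sum_{\mathbf v\setminus\mathbf a}P(\mathbf v),\mathcal G[\mathbf A],\mathsf{type})$. 3. $\mathsf{cc}_{\mathcal G}=\{\mathbf V\}$: yield $\sum_{\mathbf v\setminus(\mathbf y\cup\mathbf x)}P(\mathbf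 v)$ if $\mathsf{type}=\ell$, and $\sum_{\mathbf v\setminus(\mathbf y\cup\mathbf x)}\{P(\mathbf v)+1-\sum_{\mathbf v\setminus\mathbf x}P(\mathbf v)\}$ if $\mathsf{type}=u$. 4. $\mathbf C\in\mathsf{cc}_{\mathcal G}$: yield $\sum_{\mathbf c\setminus\mathbf y}\prod_{V_i\in\mathbf C}P(v_i\mid\mathbf v_\pi^{(i-1)})$. 5. $\mathbf C\subsetneq\mathbf C'\in\mathsf{cc}_{\mathcal G}$: yield $\mathrm{paID}(\mathbf y,\mathbf x\cap\mathbf C',\prod_{V_i\in\mathbf C'}P(v_i\mid\mathbf v_\pi^{(i-1)}),\mathcal G[\mathbf C'],\mathsf{type})$. **Proposition.** Let $\mathbf X,\mathbf Y\subseteq\mathbf V$ be disjoint. (a) *Soundness.* Every expression yielded by $\mathrm{paTR}(\mathbf y,\mathbf x,\mathcal G,\boldsymbol\Delta,\ell)$ (resp. by $\mathrm{paTR}(\mathbf y,\mathbf x,\mathcal G,\boldsymbol\Delta,u)$), evaluated at the available distributions of any collection of SCMs that induces $\mathcal G^{\boldsymbol\Delta}$, is a lower (resp. upper) bound for $P^*_{\mathbf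 x}(\mathbf y)$, for all values $\mathbf x,\mathbf y$. (b) *Partial transportability.* If $\ell$ is any expression yielded with $\mathsf{type}=\ell$ and $u=\min\{1,u'\}$ with $u'$ any expression yielded with $\mathsf{type}=u$, then $[\ell,u]$ is a partially transportable bound for $P^*_{\mathbf x}(\mathbf y)$ with respect to $\langle\mathcal G^{\boldsymbol\Delta},\mathbb Z\rangle$: it is computed from $\mathcal P^\Pi_{\mathbb Z}$ alone, and for every collection of SCMs that induces $\mathcal G^{\boldsymbol\Delta}$, $[\ell,u]\subsetneq[0,1]$ and $P^*_{\mathbf x}(\mathbf y)\in[\ell,u]$. -/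

import Mathlib

universe uV uΩ uι uκ uU

/-! ## Mixed graphs -/

/-- A graph with directed and bidirected edges on a finite set of vertices. -/
structure MixedGraph (N : Type*) where
  verts : Finset N
  dir : N → N → Prop
  bi : N → N → Prop

namespace MixedGraph

section Basic

variable {N : Type*} [DecidableEq N]

/-- The induced subgraph `G[W]`. -/
def induce (G : MixedGraph N) (W : Finset N) : MixedGraph N where
  verts := G.verts ∩ W
  dir a b := G.dir a b ∧ a ∈ W ∧ b ∈ W
  bi a b := G.bi a b ∧ a ∈ W ∧ b ∈ W

/-- Deletion of vertices, `G \ X`. -/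
def del (G : MixedGraph N) (X : Finset N) : MixedGraph N :=
  G.induce (G.verts \ X)

/-- `G` with every edge that has an arrowhead at a vertex of `X` removed. -/
def cutIncoming (G : MixedGraph N) (X : Finset N) : MixedGraph N where
  verts := G.verts
  dir a b := G.dir a b ∧ b ∉ X
  bi a b := G.bi a b ∧ a ∉ X ∧ b ∉ X

open Classical in
/-- The ancestors of `Y` in `G` (the vertices of `Y` included). -/
noncomputable def An (G : MixedGraph N) (Y : Finset N) : Finset N :=
  G.verts.filter fun a => ∃ y ∈ Y, Relation.ReflTransGen G.dir a y

open Classical in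
/-- The vertex sets of the maximal c-components of `G`, that is, of the classes of vertices
connected by bidirected edges. -/
noncomputable def cc (G : MixedGraph N) : Finset (Finset N) :=
  G.verts.image fun a => G.verts.filter fun b => Relation.ReflTransGen G.bi a b

end Basic

/-! ## d-separation -/

/-- The way in which an edge is traversed along a path: `a → b`, `a ← b` or `a ↔ b`. -/
inductive Mark
  | fwd
  | bwd
  | bid

variable {N : Type*}

/-- `G` has an edge that leads from `a` to `b` in the given way. -/
def Step (G : MixedGraph N) (a : N) : Mark → N → Prop
  | .fwd, b => G.dir a b
  | .bwd, b => G.dir b a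
  | .bid, b => G.bi a b

/-- An inner vertex of a path, entered by `m` and left by `n`, is a collider if both edges have
an arrowhead at it. -/
def IsCollider (m n : Mark) : Prop := m ≠ Mark.bwd ∧ n ≠ Mark.fwd

/-- The inner vertex `b`, entered by `m` and left by `n`, does not block the path relative
to `Z`: a collider is an ancestor of a member of `Z`, a non-collider is not in `Z`. -/
def OpenAt (G : MixedGraph N) (Z : Finset N) (m : Mark) (b : N) (n : Mark) : Prop :=
  (IsCollider m n → ∃ z ∈ Z, Relation.ReflTransGen G.dir b z) ∧ (¬ IsCollider m n → b ∉ Z)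

/-- `OpenPath G Z a l m b`: there is a path from `a` to `b` in `G`, d-connecting relative to `Z`,
whose vertices, all distinct, are listed in `l` from last to first, and whose last edge is
traversed as `m`. -/
inductive OpenPath (G : MixedGraph N) (Z : Finset N) (a : N) : List N → Mark → N → Prop
  | single {m : Mark} {b : N} : G.Step a m b → a ≠ b → OpenPath G Z a [b, a] m b
  | snoc {l : List N} {m n : Mark} {b c : N} : OpenPath G Z a l m b → G.Step b n c → c ∉ l →
      G.OpenAt Z m b n → OpenPath G Z a (c :: l) n c

/-- The disjoint sets `A` and `B` are d-separated by `Z` in `G`. -/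
def DSep (G : MixedGraph N) (A B Z : Finset N) : Prop :=
  ∀ a ∈ A, ∀ b ∈ B, ∀ l m, ¬ G.OpenPath Z a l m b

/-! ## Selection diagrams -/

variable {V ι : Type*} [Fintype V] [DecidableEq V]

open Classical in
/-- The collective selection diagram of `G` with discrepancies `Δ`: the vertex `Sum.inl v` is
the variable `v`, and the vertex `Sum.inr v`, which exists for `v` in some `Δ i`, is the
selection variable that points to `v`. -/
noncomputable def selectionDiagram (G : MixedGraph V) (Δ : ι → Finset V) :
    MixedGraph (V ⊕ V) where
  verts := G.verts.disjSum (Finset.univ.filter fun v => ∃ i, v ∈ Δ i)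
  dir
    | .inl a, .inl b => G.dir a b
    | .inr a, .inl b => a = b ∧ b ∈ G.verts ∧ ∃ i, b ∈ Δ i
    | _, .inr _ => False
  bi
    | .inl a, .inl b => G.bi a b
    | _, _ => False

/-- The set of variables `X`, as vertices of a selection diagram. -/
def obs (X : Finset V) : Finset (V ⊕ V) := X.map Function.Embedding.inl

/-- The selection variables that point to the variables in `D`. -/
def sel (D : Finset V) : Finset (V ⊕ V) := D.map Function.Embedding.inr

end MixedGraph

/-- A causal diagram over the variables `V`: an acyclic directed mixed graph. -/
structure CausalDiagram (V : Type*) [Fintype V] extends MixedGraph V where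
  verts_eq : verts = Finset.univ
  bi_symm : ∀ a b, bi a b → bi b a
  bi_irrefl : ∀ a, ¬ bi a a
  acyclic : ∀ a, ¬ Relation.TransGen dir a a

/-! ## Structural causal models -/

/-- A joint assignment of values to all variables. The values `x` of a set `X` of variables are
given throughout as the restriction to `X` of such an assignment. -/
abbrev Assign {V : Type*} (Ω : V → Type*) := ∀ v, Ω v

/-- A structural causal model with endogenous variables `V` (with values in `Ω`) and mutually
independent exogenous variables `κ` (with values in `U`). `pa v` and `exo v` are the endogenous
and the exogenous variables that are arguments of the mechanism `f v`, and `μ k` is the law of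
the exogenous variable `k`. -/
structure SCM {V : Type*} (Ω : V → Type*) {κ : Type*} (U : κ → Type*)
    [∀ k, MeasurableSpace (U k)] where
  pa : V → Set V
  exo : V → Set κ
  f : ∀ v, Assign Ω → (∀ k, U k) → Ω v
  f_local : ∀ v s t u u₁, (∀ w ∈ pa v, s w = t w) → (∀ k ∈ exo v, u k = u₁ k) →
    f v s u = f v t u₁
  f_meas : ∀ v s a, MeasurableSet {u | f v s u = a}
  μ : ∀ k, MeasureTheory.Measure (U k)
  prob : ∀ k, MeasureTheory.IsProbabilityMeasure (μ k)

namespace SCM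

variable {V : Type*} [Fintype V] {Ω : V → Type*} {κ : Type*} {U : κ → Type*}
  [∀ k, MeasurableSpace (U k)]

/-- `s` solves the equations of the submodel in which `X` is set to its values in `x`, for the
unit `u`. -/
def IsSolution (M : SCM Ω U) (X : Finset V) (x : Assign Ω) (u : ∀ k, U k) (s : Assign Ω) : Prop :=
  (∀ v ∈ X, s v = x v) ∧ ∀ v ∉ X, s v = M.f v s u

/-- The interventional probability `P_x(y)`, where `x` and `y` are the restrictions of `v` to
`X` and `Y`: the probability that the solution of the submodel in which `X` is set to `x`
(unique if the model is acyclic) has the value `y` on `Y`. -/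
noncomputable def doProb [Fintype κ] (M : SCM Ω U) (X Y : Finset V) (v : Assign Ω) : ℝ :=
  (MeasureTheory.Measure.pi M.μ).real {u | ∃ s, M.IsSolution X v u s ∧ ∀ w ∈ Y, s w = v w}

/-- The model conforms to the causal diagram `G`: arguments of a mechanism are parents in `G`, and
variables that share an exogenous variable are joined by a bidirected edge. -/
def CompatibleWith (M : SCM Ω U) (G : CausalDiagram V) : Prop :=
  (∀ v, ∀ w ∈ M.pa v, G.dir w v) ∧
    ∀ v w, v ≠ w → (M.exo v ∩ M.exo w).Nonempty → G.bi v w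

end SCM

/-- A collection of models with common variables: one for the target domain and one for each
source domain `i : ι`. -/
structure ModelCollection {V : Type uV} (Ω : V → Type uΩ)
    (ι : Type uι) where
  κ : Type uκ
  [fintype_κ : Fintype κ]
  U : κ → Type uU
  [measurable_U : ∀ k, MeasurableSpace (U k)]
  target : SCM Ω U
  source : ι → SCM Ω U

attribute [instance] ModelCollection.fintype_κ ModelCollection.measurable_U

/-- The available distributions, that is, those of the experiments `𝒵`: for a source domain `i`
and an experiment `Z ∈ 𝒵 i`, the value at `v` stands for `P^i_z(v \ z)`, where `z` is the
restriction of `v` to `Z`. -/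
abbrev ExpData {V ι : Type*} (Ω : V → Type*) (𝒵 : ι → Finset (Finset V)) :=
  ∀ i : ι, {Z : Finset V // Z ∈ 𝒵 i} → Assign Ω → ℝ

namespace ModelCollection

variable {V ι : Type*} [Fintype V] [DecidableEq V] {Ω : V → Type*}

/-- The models induce the collective selection diagram given by `G` and `Δ`: all of them conform
to `G`, and the mechanism of `v` and the laws of its exogenous arguments differ between the target
and the source `i` only if `v ∈ Δ i`. -/
def Induces (𝓜 : ModelCollection Ω ι) (G : CausalDiagram V) (Δ : ι → Finset V) : Prop :=
  𝓜.target.CompatibleWith G ∧ (∀ i, (𝓜.source i).CompatibleWith G) ∧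
    ∀ i, ∀ v ∉ Δ i, (𝓜.source i).f v = 𝓜.target.f v ∧
      (𝓜.source i).exo v = 𝓜.target.exo v ∧
      ∀ k ∈ 𝓜.target.exo v, (𝓜.source i).μ k = 𝓜.target.μ k

/-- The distributions of the experiments `𝒵` in the given models. -/
noncomputable def data (𝓜 : ModelCollection Ω ι) (𝒵 : ι → Finset (Finset V)) : ExpData Ω 𝒵 :=
  fun i Z v => (𝓜.source i).doProb Z.1 Z.1ᶜ v

/-- All available distributions are strictly positive. -/
def Positive (𝓜 : ModelCollection Ω ι) (𝒵 : ι → Finset (Finset V)) : Prop :=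
  ∀ i Z v, 0 < 𝓜.data 𝒵 i Z v

end ModelCollection

/-! ## Expressions -/

section Expressions

variable {V ι : Type*} [Fintype V] [DecidableEq V] {Ω : V → Type*} [∀ v, Fintype (Ω v)]
  {𝒵 : ι → Finset (Finset V)}

/-- The assignment that equals `v` on `W` and `w` off `W`. -/
def mergeOn (W : Finset V) (v w : Assign Ω) : Assign Ω := fun a => if a ∈ W then v a else w a

/-- An expression in the available distributions; its free variables take their values from the
assignment. -/
abbrev Expression {V ι : Type*} (Ω : V → Type*) (𝒵 : ι → Finset (Finset V)) :=
  ExpData Ω 𝒵 → Assign Ω → ℝ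

namespace Expression

open Classical in
/-- `∑_t e`, the sum over all values `t` of the variables in `T`. -/
noncomputable def sum (T : Finset V) (e : Expression Ω 𝒵) : Expression Ω 𝒵 :=
  fun D v => ∑ w ∈ Finset.univ.filter (fun w : Assign Ω => ∀ a ∉ T, w a = v a), e D w

/-- `P(v_i | v_π^{(i-1)})` for a distribution `P` over the variables in `W` ordered by `π`. -/
noncomputable def cond (W : Finset V) (π : V → ℕ) (P : Expression Ω 𝒵) (i : V) :
    Expression Ω 𝒵 :=
  fun D v => sum (W.filter fun a => π i < π a) P D v / sum (W.filter fun a => π i ≤ π a) P D v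

/-- `∏_{V_i ∈ C} P(v_i | v_π^{(i-1)})` for a distribution `P` over the variables in `W`. -/
noncomputable def condProd (W : Finset V) (π : V → ℕ) (P : Expression Ω 𝒵) (C : Finset V) :
    Expression Ω 𝒵 :=
  fun D v => ∏ i ∈ C, cond W π P i D v

/-- The distribution `P^i_{z \ W, x ∩ Z}` over the variables in `W \ Z`, where the values of `Z`
outside `W` are those in `z`. -/
noncomputable def experiment (i : ι) (Z : {Z : Finset V // Z ∈ 𝒵 i}) (W : Finset V)
    (z : Assign Ω) : Expression Ω 𝒵 :=
  fun D v => sum (W ∪ Z.1)ᶜ (fun D => D i Z) D (mergeOn W v z)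

end Expression

end Expressions

/-! ## The algorithm -/

/-- The type of a bound: lower or upper. -/
inductive BoundType
  | lower
  | upper

/-- `π` is a topological order of the vertices of `G`. -/
def IsTopologicalOrder {V : Type*} (G : MixedGraph V) (π : V → ℕ) : Prop :=
  Set.InjOn π G.verts ∧ ∀ a b, G.dir a b → π a < π b

section Algorithm

variable {V ι : Type*} [Fintype V] [DecidableEq V] {Ω : V → Type*} [∀ v, Fintype (Ω v)]
  {𝒵 : ι → Finset (Finset V)}

/-- The natural bound of the given type, for `P` over the variables in `W`. -/
noncomputable def naturalBound (Y X W : Finset V) (P : Expression Ω 𝒵) :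
    BoundType → Expression Ω 𝒵
  | .lower => Expression.sum (W \ (Y ∪ X)) P
  | .upper => Expression.sum (W \ (Y ∪ X))
      fun D v => P D v + 1 - Expression.sum (W \ X) P D v

/-- `PaID t Y X P G e`: the procedure `paID(y, x, P, G, t)` yields the expression `e`. The
constructors are the branches of the procedure, tried in this order. -/
inductive PaID (t : BoundType) :
    Finset V → Finset V → Expression Ω 𝒵 → MixedGraph V → Expression Ω 𝒵 → Prop
  | noIntervention {Y X : Finset V} {P : Expression Ω 𝒵} {G : MixedGraph V} :
      X = ∅ →
      PaID t Y X P G (Expression.sum (G.verts \ Y) P)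
  | ancestors {Y X : Finset V} {P : Expression Ω 𝒵} {G : MixedGraph V} {e : Expression Ω 𝒵} :
      X ≠ ∅ → G.verts ≠ G.An Y →
      PaID t Y (X ∩ G.An Y) (Expression.sum (G.verts \ G.An Y) P) (G.induce (G.An Y)) e →
      PaID t Y X P G e
  | natural {Y X : Finset V} {P : Expression Ω 𝒵} {G : MixedGraph V} :
      X ≠ ∅ → G.verts = G.An Y → G.cc = {G.verts} →
      PaID t Y X P G (naturalBound Y X G.verts P t)
  | component {Y X : Finset V} {P : Expression Ω 𝒵} {G : MixedGraph V} (C : Finset V)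
      (π : V → ℕ) :
      X ≠ ∅ → G.verts = G.An Y → G.cc ≠ {G.verts} → (G.del X).cc = {C} →
      IsTopologicalOrder G π → C ∈ G.cc →
      PaID t Y X P G (Expression.sum (C \ Y) (Expression.condProd G.verts π P C))
  | subcomponent {Y X : Finset V} {P : Expression Ω 𝒵} {G : MixedGraph V} {e : Expression Ω 𝒵}
      (C K : Finset V) (π : V → ℕ) :
      X ≠ ∅ → G.verts = G.An Y → G.cc ≠ {G.verts} → (G.del X).cc = {C} →
      IsTopologicalOrder G π → C ⊂ K → K ∈ G.cc →
      PaID t Y (X ∩ K) (Expression.condProd G.verts π P K) (G.induce K) e →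
      PaID t Y X P G e

/-- `PaTR t Y X G Δ e`: the algorithm `paTR(y, x, G, Δ, t)` yields the expression `e`. Each
constructor is a line of the algorithm. Lines that need values of variables on which the query
puts no condition may use any fixed values (`z` and `w` below). -/
inductive PaTR (t : BoundType) :
    Finset V → Finset V → MixedGraph V → (ι → Finset V) → Expression Ω 𝒵 → Prop
  | direct {Y X : Finset V} {G : MixedGraph V} {Δ : ι → Finset V} (i : ι)
      (Z : {Z : Finset V // Z ∈ 𝒵 i}) (z : Assign Ω) :
      X = Z.1 ∩ G.verts →
      ((G.selectionDiagram Δ).del (MixedGraph.obs X)).DSep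
        (MixedGraph.sel (Δ i)) (MixedGraph.obs Y) ∅ →
      PaTR t Y X G Δ
        (Expression.sum (G.verts \ (Y ∪ X)) (Expression.experiment i Z G.verts z))
  | nonAncestors {Y X : Finset V} {G : MixedGraph V} {Δ : ι → Finset V} {e : Expression Ω 𝒵}
      (R : Finset V) :
      R = G.verts \ G.An Y → R ≠ ∅ →
      PaTR t Y (X \ R) (G.del R) (fun i => Δ i \ R) e →
      PaTR t Y X G Δ e
  | extend {Y X : Finset V} {G : MixedGraph V} {Δ : ι → Finset V} {e : Expression Ω 𝒵}
      (R : Finset V) (w : Assign Ω) :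
      G.verts \ G.An Y = ∅ →
      R = (G.verts \ X) \ (G.cutIncoming X).An Y → R ≠ ∅ →
      PaTR t Y (X ∪ R) G Δ e →
      PaTR t Y X G Δ (fun D v => e D (mergeOn R w v))
  | factorize {Y X : Finset V} {G : MixedGraph V} {Δ : ι → Finset V}
      (E : Finset V → Expression Ω 𝒵) :
      G.verts \ G.An Y = ∅ → (G.verts \ X) \ (G.cutIncoming X).An Y = ∅ →
      1 < (G.del X).cc.card →
      (∀ C ∈ (G.del X).cc, PaTR t C (G.verts \ C) G Δ (E C)) →
      PaTR t Y X G Δ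
        (Expression.sum (G.verts \ (Y ∪ X)) fun D v => ∏ C ∈ (G.del X).cc, E C D v)
  | identify {Y X : Finset V} {G : MixedGraph V} {Δ : ι → Finset V} {e : Expression Ω 𝒵} (i : ι)
      (Z : {Z : Finset V // Z ∈ 𝒵 i}) (z : Assign Ω) :
      G.verts \ G.An Y = ∅ → (G.verts \ X) \ (G.cutIncoming X).An Y = ∅ →
      ¬ 1 < (G.del X).cc.card →
      Δ i ∩ (G.verts \ X) = ∅ → Z.1 ∩ G.verts ⊆ X →
      PaID t Y (X \ Z.1) (Expression.experiment i Z G.verts z) (G.del (Z.1 ∩ X)) e →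
      PaTR t Y X G Δ e

end Algorithm

/-! ## Partial transportability -/

/-- `[ℓ, u]`, computed from the available distributions alone, is a partially transportable bound
for `P*_x(y)` with respect to the selection diagram of `G` and `Δ` and the experiments `𝒵`: for
all collections of models that induce the selection diagram (with positive available
distributions) it is strictly contained in `[0, 1]` and contains `P*_x(y)`. -/
def IsPartiallyTransportableBound {V : Type uV} {ι : Type uι} [Fintype V]
    [DecidableEq V] {Ω : V → Type uΩ} (G : CausalDiagram V) (Δ : ι → Finset V)
    (𝒵 : ι → Finset (Finset V)) (X Y : Finset V) (v : Assign Ω) (ℓ u : ExpData Ω 𝒵 → ℝ) : Prop :=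
  ∀ 𝓜 : ModelCollection.{uV, uΩ, uι, uκ, uU} Ω ι, 𝓜.Induces G Δ → 𝓜.Positive 𝒵 →
    Set.Icc (ℓ (𝓜.data 𝒵)) (u (𝓜.data 𝒵)) ⊂ Set.Icc 0 1 ∧
      𝓜.target.doProb X Y v ∈ Set.Icc (ℓ (𝓜.data 𝒵)) (u (𝓜.data 𝒵))

/-! Every quantity in the algorithm is a sum of c-factors. The c-factor `Q[W]` at `v` (`cFactor`) is
the probability of the set of units whose mechanisms in `W` all agree with `v`. Acyclicity makes the
solution of a submodel exist and be unique, so these events are disjoint for different assignments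
of `W`, and `P_x(y)` is the sum of `Q[Xᶜ]` over the variables outside `X ∪ Y` (`doProb_eq`).

Five properties of c-factors carry the proof. `Q` factorizes over sets without bidirected edges
between them, because their exogenous arguments are disjoint (`cFactor_union`). Summing `Q[W]` over
the complement in `W` of an ancestral subset `A` gives `Q[A]` (`marginal_cFactor`). `Q[W]` depends
only on the mechanisms of `W` and their exogenous laws, so it is shared by two domains that do not
differ on `W` (`cFactor_congr_model`). It depends only on the values of `W` and its parents, so the
arbitrarily fixed values are harmless (`cFactor_congr_assign`). Finally, `Q[W]` is antitone in `W`,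
and `Q[W \ X]` exceeds `Q[W]` by at most the probability that `X ∩ W` does not take its value by
itself (`cFactor_anti`, `cFactor_sdiff_le`); these give the natural bounds, the only place where
equality is lost.

Soundness is then an induction over each procedure. Lower bounds are carried along as strictly
positive: this lets them be multiplied, and it excludes `0` from the final interval, which makes the
inclusion in `[0, 1]` proper. -/

set_option linter.unusedSectionVars false

/-! ## Marginals -/

section Marginal

variable {V ι : Type*} [Fintype V] [DecidableEq V] {Ω : V → Type*} [∀ v, Fintype (Ω v)]
  {𝒵 : ι → Finset (Finset V)}

open Classical in
/-- The sum of `g` over all values of the variables in `T`. -/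
noncomputable def marginal (T : Finset V) (g : Assign Ω → ℝ) (v : Assign Ω) : ℝ :=
  ∑ w ∈ Finset.univ.filter (fun w : Assign Ω => ∀ a ∉ T, w a = v a), g w

theorem Expression.sum_apply (T : Finset V) (e : Expression Ω 𝒵) (D : ExpData Ω 𝒵)
    (v : Assign Ω) : Expression.sum T e D v = marginal T (e D) v := rfl

theorem marginal_congr_assign {T : Finset V} {v w : Assign Ω} (g : Assign Ω → ℝ)
    (h : ∀ a ∉ T, v a = w a) : marginal T g v = marginal T g w := by
  unfold marginal
  congr 1
  ext s
  simp only [Finset.mem_filter, Finset.mem_univ, true_and]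
  exact forall₂_congr fun a ha => by rw [h a ha]

theorem marginal_mono {T : Finset V} {g h : Assign Ω → ℝ} (hgh : ∀ v, g v ≤ h v) (v : Assign Ω) :
    marginal T g v ≤ marginal T h v :=
  Finset.sum_le_sum fun w _ => hgh w

theorem marginal_pos {T : Finset V} {g : Assign Ω → ℝ} (hg : ∀ v, 0 < g v) (v : Assign Ω) :
    0 < marginal T g v :=
  Finset.sum_pos (fun w _ => hg w) ⟨v, by simp⟩

theorem marginal_empty (g : Assign Ω → ℝ) (v : Assign Ω) : marginal ∅ g v = g v :=
  (Finset.sum_congr (by ext w; simp [funext_iff]) fun _ _ => rfl).trans (Finset.sum_singleton g v)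

theorem marginal_marginal {T S : Finset V} (hTS : Disjoint T S) (g : Assign Ω → ℝ)
    (v : Assign Ω) : marginal T (marginal S g) v = marginal (T ∪ S) g v := by
  classical
  unfold marginal
  -- The sum over `T ∪ S` is grouped by the assignment obtained from resetting `S` to its values in
  -- `v`.
  rw [← Finset.sum_fiberwise_of_maps_to
    (s := Finset.univ.filter (fun w : Assign Ω => ∀ a ∉ T ∪ S, w a = v a))
    (g := fun w : Assign Ω => mergeOn S v w)
    (t := Finset.univ.filter (fun w : Assign Ω => ∀ a ∉ T, w a = v a))]
  · refine Finset.sum_congr rfl fun t ht => Finset.sum_congr ?_ fun _ _ => rfl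
    simp only [Finset.mem_filter, Finset.mem_univ, true_and] at ht
    ext w
    simp only [Finset.mem_filter, Finset.mem_univ, true_and, Finset.mem_union, not_or]
    constructor
    · intro h
      refine ⟨fun a ha => (h a ha.2).trans (ht a ha.1), funext fun a => ?_⟩
      by_cases ha : a ∈ S
      · simp [mergeOn, ha, ht a (Finset.disjoint_right.1 hTS ha)]
      · simp [mergeOn, ha, h a ha]
    · rintro ⟨-, h⟩ a ha
      rw [← h]
      simp [mergeOn, ha]
  · intro w hw
    simp only [Finset.mem_filter, Finset.mem_univ, true_and, Finset.mem_union, not_or] at hw ⊢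
    intro a ha
    by_cases haS : a ∈ S
    · simp [mergeOn, haS]
    · simp [mergeOn, haS, hw a ⟨ha, haS⟩]

end Marginal

/-! ## Events of a product space that depend on some of the coordinates -/

section ProductSpace

open MeasureTheory ProbabilityTheory

variable {κ : Type*} [Fintype κ] {U : κ → Type*} [∀ k, MeasurableSpace (U k)]

/-- Filling the coordinates off `S` with fixed values is measurable and does not affect membership
in `E`, so the base of the cylinder is the preimage of `E` under this filling. -/
theorem exists_preimage_restrict [∀ k, Nonempty (U k)] {S : Finset κ} {E : Set (∀ k, U k)}
    (hE : MeasurableSet E) (hS : ∀ u u', (∀ k ∈ S, u k = u' k) → (u ∈ E ↔ u' ∈ E)) :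
    ∃ E' : Set (∀ k : S, U k), MeasurableSet E' ∧ E = S.restrict ⁻¹' E' := by
  classical
  let u₀ : ∀ k, U k := fun k => Classical.arbitrary _
  let fill : (∀ k : S, U k) → ∀ k, U k := fun r k => if h : k ∈ S then r ⟨k, h⟩ else u₀ k
  have hfill : Measurable fill := by
    refine measurable_pi_lambda _ fun k => ?_
    by_cases h : k ∈ S
    · simp only [fill, h, dif_pos]
      exact measurable_pi_apply _
    · simp only [fill, h, dif_neg, not_false_eq_true]
      exact measurable_const
  refine ⟨fill ⁻¹' E, hfill hE, ?_⟩
  ext u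
  exact hS _ _ fun k hk => by simp [fill, hk]

/-- Both events are cylinders over disjoint blocks of independent coordinates. -/
theorem measureReal_pi_inter_of_disjoint (μ : ∀ k, Measure (U k))
    [∀ k, IsProbabilityMeasure (μ k)] {S T : Finset κ} (hST : Disjoint S T)
    {E F : Set (∀ k, U k)} (hE : MeasurableSet E) (hF : MeasurableSet F)
    (hES : ∀ u u', (∀ k ∈ S, u k = u' k) → (u ∈ E ↔ u' ∈ E))
    (hFT : ∀ u u', (∀ k ∈ T, u k = u' k) → (u ∈ F ↔ u' ∈ F)) :
    (Measure.pi μ).real (E ∩ F) = (Measure.pi μ).real E * (Measure.pi μ).real F := by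
  have : ∀ k, Nonempty (U k) := fun k => nonempty_of_isProbabilityMeasure (μ k)
  obtain ⟨E', hE', rfl⟩ := exists_preimage_restrict hE hES
  obtain ⟨F', hF', rfl⟩ := exists_preimage_restrict hF hFT
  have hind : iIndepFun (fun k (u : ∀ k, U k) => u k) (Measure.pi μ) :=
    iIndepFun_pi (X := fun _ => id) fun _ => aemeasurable_id
  have := (hind.indepFun_finset S T hST fun k => measurable_pi_apply k).measure_inter_preimage_eq_mul
    E' F' hE' hF'
  simp only [Measure.real, ← ENNReal.toReal_mul]
  exact congrArg ENNReal.toReal this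

theorem measureReal_pi_congr (μ ν : ∀ k, Measure (U k)) [∀ k, IsProbabilityMeasure (μ k)]
    [∀ k, IsProbabilityMeasure (ν k)] {S : Finset κ} (hμν : ∀ k ∈ S, μ k = ν k)
    {E : Set (∀ k, U k)} (hE : MeasurableSet E)
    (hES : ∀ u u', (∀ k ∈ S, u k = u' k) → (u ∈ E ↔ u' ∈ E)) :
    (Measure.pi μ).real E = (Measure.pi ν).real E := by
  have : ∀ k, Nonempty (U k) := fun k => nonempty_of_isProbabilityMeasure (μ k)
  have hmeas := hE
  obtain ⟨E', hE', rfl⟩ := exists_preimage_restrict hE hES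
  have h (ρ : ∀ k, Measure (U k)) [∀ k, IsProbabilityMeasure (ρ k)] :
      Measure.pi ρ (S.restrict ⁻¹' E') = Measure.pi (fun k : S => ρ k) E' := by
    rw [← piContent_eq_measure_pi ρ hmeas]
    exact piContent_cylinder ρ hE'
  simp only [Measure.real, h]
  congr 3
  ext1 k
  exact hμν k k.2

end ProductSpace

/-! ## c-factors -/

namespace SCM

open MeasureTheory

variable {V : Type*} [Fintype V] [DecidableEq V] {Ω : V → Type*} {κ : Type*} [Fintype κ]
  {U : κ → Type*} [∀ k, MeasurableSpace (U k)] {M N : SCM Ω U} {G : CausalDiagram V}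

instance (k : κ) : IsProbabilityMeasure (M.μ k) := M.prob k

/-- The units for which the mechanisms of the variables in `W` agree with `v`. -/
def agreement (M : SCM Ω U) (W : Finset V) (v : Assign Ω) : Set (∀ k, U k) :=
  {u | ∀ w ∈ W, M.f w v u = v w}

/-- The c-factor `Q[W]`: the probability of the values of `W` after all other variables are set
to their values. -/
noncomputable def cFactor (M : SCM Ω U) (W : Finset V) (v : Assign Ω) : ℝ :=
  (Measure.pi M.μ).real (M.agreement W v)

theorem measurableSet_agreement (W : Finset V) (v : Assign Ω) :
    MeasurableSet (M.agreement W v) := by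
  have : M.agreement W v = ⋂ w ∈ W, {u | M.f w v u = v w} := by
    ext u; simp [agreement]
  rw [this]
  exact Finset.measurableSet_biInter _ fun w _ => M.f_meas _ _ _

open Classical in
/-- The exogenous arguments of the mechanisms of the variables in `W`. -/
noncomputable def exoOf (M : SCM Ω U) (W : Finset V) : Finset κ :=
  Finset.univ.filter fun k => ∃ w ∈ W, k ∈ M.exo w

theorem agreement_iff_of_eqOn_exoOf {W : Finset V} {v : Assign Ω} (u u' : ∀ k, U k)
    (h : ∀ k ∈ M.exoOf W, u k = u' k) : u ∈ M.agreement W v ↔ u' ∈ M.agreement W v := by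
  refine forall₂_congr fun w hw => ?_
  rw [M.f_local w v v u u' (fun _ _ => rfl)
    fun k hk => h k (by simpa [exoOf] using ⟨w, hw, hk⟩)]

theorem cFactor_empty (v : Assign Ω) : M.cFactor ∅ v = 1 := by
  simp [cFactor, agreement]

theorem cFactor_nonneg (W : Finset V) (v : Assign Ω) : 0 ≤ M.cFactor W v :=
  measureReal_nonneg

theorem cFactor_anti {A W : Finset V} (h : A ⊆ W) (v : Assign Ω) :
    M.cFactor W v ≤ M.cFactor A v :=
  measureReal_mono fun _ hu w hw => hu w (h hw)

/-- An exogenous variable shared by `A` and `B` would force a bidirected edge between them, so the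
two agreement events depend on disjoint sets of independent variables. -/
theorem cFactor_union (hM : M.CompatibleWith G) {A B : Finset V} (hAB : Disjoint A B)
    (hbi : ∀ a ∈ A, ∀ b ∈ B, ¬ G.bi a b) (v : Assign Ω) :
    M.cFactor (A ∪ B) v = M.cFactor A v * M.cFactor B v := by
  have h : M.agreement (A ∪ B) v = M.agreement A v ∩ M.agreement B v := by
    ext u
    simp only [agreement, Finset.mem_union, Set.mem_inter_iff, Set.mem_ofPred_eq]
    exact ⟨fun h => ⟨fun w hw => h w (.inl hw), fun w hw => h w (.inr hw)⟩,
      fun h w hw => hw.elim (h.1 w) (h.2 w)⟩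
  rw [cFactor, h]
  refine measureReal_pi_inter_of_disjoint M.μ (S := M.exoOf A) (T := M.exoOf B) ?_
    (measurableSet_agreement _ _) (measurableSet_agreement _ _)
    agreement_iff_of_eqOn_exoOf agreement_iff_of_eqOn_exoOf
  rw [Finset.disjoint_left]
  intro k hkA hkB
  simp only [exoOf, Finset.mem_filter, Finset.mem_univ, true_and] at hkA hkB
  obtain ⟨a, ha, hka⟩ := hkA
  obtain ⟨b, hb, hkb⟩ := hkB
  exact hbi a ha b hb
    (hM.2 a b (fun hab => Finset.disjoint_left.1 hAB ha (hab ▸ hb)) ⟨k, hka, hkb⟩)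

theorem cFactor_biUnion (hM : M.CompatibleWith G) (F : Finset (Finset V))
    (hdisj : ∀ A ∈ F, ∀ B ∈ F, A ≠ B → Disjoint A B)
    (hbi : ∀ A ∈ F, ∀ B ∈ F, A ≠ B → ∀ a ∈ A, ∀ b ∈ B, ¬ G.bi a b) (v : Assign Ω) :
    M.cFactor (F.biUnion id) v = ∏ C ∈ F, M.cFactor C v := by
  induction F using Finset.induction_on with
  | empty => simp [cFactor_empty]
  | insert A F hA ih =>
    have hne : ∀ B ∈ F, A ≠ B := fun B hB h => hA (h ▸ hB)
    rw [Finset.prod_insert hA, Finset.biUnion_insert, ← ih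
      (fun B hB C hC => hdisj B (Finset.mem_insert_of_mem hB) C (Finset.mem_insert_of_mem hC))
      (fun B hB C hC => hbi B (Finset.mem_insert_of_mem hB) C (Finset.mem_insert_of_mem hC))]
    refine cFactor_union hM ?_ ?_ v
    · rw [Finset.disjoint_biUnion_right]
      exact fun B hB =>
        hdisj A (Finset.mem_insert_self _ _) B (Finset.mem_insert_of_mem hB) (hne B hB)
    · intro a ha b hb
      obtain ⟨B, hB, hb⟩ := Finset.mem_biUnion.1 hb
      exact hbi A (Finset.mem_insert_self _ _) B (Finset.mem_insert_of_mem hB) (hne B hB) a ha b hb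

/-- This is what transports a c-factor from a source domain to the target. -/
theorem cFactor_congr_model {W : Finset V} (hf : ∀ w ∈ W, N.f w = M.f w)
    (hexo : ∀ w ∈ W, ∀ k ∈ M.exo w, N.μ k = M.μ k) (v : Assign Ω) :
    N.cFactor W v = M.cFactor W v := by
  have h : N.agreement W v = M.agreement W v := by
    ext u
    exact forall₂_congr fun w hw => by rw [hf w hw]
  rw [cFactor, h]
  refine measureReal_pi_congr N.μ M.μ (S := M.exoOf W) ?_ (measurableSet_agreement _ _)
    agreement_iff_of_eqOn_exoOf
  intro k hk
  simp only [exoOf, Finset.mem_filter, Finset.mem_univ, true_and] at hk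
  obtain ⟨w, hw, hk⟩ := hk
  exact hexo w hw k hk

/-- `Q[W]` is a function of the values of `W` and of its parents. -/
theorem cFactor_congr_assign (hM : M.CompatibleWith G) {W : Finset V} {v v' : Assign Ω}
    (hW : ∀ w ∈ W, v w = v' w) (hpa : ∀ w ∈ W, ∀ a, G.dir a w → v a = v' a) :
    M.cFactor W v = M.cFactor W v' := by
  have h : M.agreement W v = M.agreement W v' := by
    ext u
    refine forall₂_congr fun w hw => ?_
    rw [M.f_local w v v' u u (fun a ha => hpa w hw a (hM.1 w a ha)) (fun _ _ => rfl), hW w hw]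
  rw [cFactor, cFactor, h]

end SCM

/-! ### Acyclicity, solutions of submodels, and sums of c-factors -/

theorem CausalDiagram.wellFounded_dir {V : Type*} [Fintype V] (G : CausalDiagram V) :
    WellFounded G.dir := by
  have : Std.Irrefl (Relation.TransGen G.dir) := ⟨G.acyclic⟩
  exact WellFounded.mono (Finite.wellFounded_of_trans_of_irrefl (Relation.TransGen G.dir))
    fun _ _ => Relation.TransGen.single

namespace SCM

open MeasureTheory

variable {V : Type*} [Fintype V] [DecidableEq V] {Ω : V → Type*} {κ : Type*} [Fintype κ]
  {U : κ → Type*} [∀ k, MeasurableSpace (U k)] {M : SCM Ω U} {G : CausalDiagram V}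

/-- By induction along the directed edges: a mechanism reads only parents, where `s` and `t` already
agree. -/
theorem CompatibleWith.solution_unique (hM : M.CompatibleWith G) {T : Finset V} {u : ∀ k, U k}
    {s t : Assign Ω} (hst : ∀ a ∉ T, s a = t a) (hs : u ∈ M.agreement T s)
    (ht : u ∈ M.agreement T t) : s = t := by
  funext a
  induction a using G.wellFounded_dir.induction with
  | _ a ih =>
    by_cases ha : a ∈ T
    · rw [← hs a ha, ← ht a ha]
      exact M.f_local a s t u u (fun w hw => ih w (hM.1 a w hw)) fun _ _ => rfl
    · exact hst a ha

theorem CompatibleWith.solution_exists (hM : M.CompatibleWith G) (T : Finset V) (u : ∀ k, U k)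
    (v : Assign Ω) : ∃ s : Assign Ω, (∀ a ∉ T, s a = v a) ∧ u ∈ M.agreement T s := by
  classical
  -- The solution is built by well-founded recursion. Non-parents receive the dummy value `v b`,
  -- which the mechanism never reads.
  let F : ∀ a, (∀ b, G.dir b a → Ω b) → Ω a := fun a r =>
    if a ∈ T then M.f a (fun b => if h : G.dir b a then r b h else v b) u else v a
  let s : Assign Ω := G.wellFounded_dir.fix F
  have hs (a : V) : s a = F a fun b _ => s b := G.wellFounded_dir.fix_eq F a
  refine ⟨s, fun a ha => by rw [hs]; simp [F, ha], fun a ha => ?_⟩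
  rw [hs a]
  simp only [F, ha, if_true]
  refine M.f_local a _ _ u u (fun w hw => ?_) fun _ _ => rfl
  simp [hM.1 a w hw]

variable [∀ v, Fintype (Ω v)]

/-- The truncated factorization. -/
theorem CompatibleWith.doProb_eq (hM : M.CompatibleWith G) (X Y : Finset V) (v : Assign Ω) :
    M.doProb X Y v = marginal (X ∪ Y)ᶜ (M.cFactor Xᶜ) v := by
  classical
  unfold marginal cFactor
  -- The sum is the measure of a union over the candidate solutions; uniqueness of the solution
  -- makes the union disjoint.
  rw [← measureReal_biUnion_finset]
  · rw [doProb]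
    congr 1
    ext u
    simp only [IsSolution, Set.mem_ofPred_eq, Set.mem_iUnion, Finset.mem_filter, Finset.mem_univ,
      true_and, agreement, Finset.mem_compl, not_not, Finset.mem_union, exists_prop]
    constructor
    · rintro ⟨s, ⟨h1, h2⟩, h3⟩
      exact ⟨s, fun a ha => ha.elim (h1 a) (h3 a), fun a ha => (h2 a ha).symm⟩
    · rintro ⟨s, h1, h2⟩
      exact ⟨s, ⟨fun a ha => h1 a (.inl ha), fun a ha => (h2 a ha).symm⟩,
        fun a ha => h1 a (.inr ha)⟩
  · intro s hs t ht hne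
    refine Set.disjoint_left.2 fun u hus hut => hne (hM.solution_unique (fun a ha => ?_) hus hut)
    simp only [Finset.coe_filter, Finset.mem_univ, true_and, Set.mem_ofPred_eq, Finset.mem_compl,
      not_not, Finset.mem_union] at hs ht ha
    rw [hs a (.inl ha), ht a (.inl ha)]
  · exact fun s _ => measurableSet_agreement _ _

/-- Summing a c-factor over the variables outside of an ancestral set. -/
theorem CompatibleWith.marginal_cFactor (hM : M.CompatibleWith G) {A W : Finset V} (hAW : A ⊆ W)
    (hA : ∀ b ∈ A, ∀ a ∈ W, G.dir a b → a ∈ A) (v : Assign Ω) :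
    marginal (W \ A) (M.cFactor W) v = M.cFactor A v := by
  -- In terms of the complement `T` of `A` in `W`: no edge leads from `T` to the rest of `W`. Hence
  -- the mechanisms of `W \ T` do not notice changes on `T`, and those of `T` can always be solved,
  -- in exactly one way.
  obtain ⟨T, hTW, hT, rfl⟩ : ∃ T ⊆ W, (∀ a ∈ T, ∀ b ∈ W, b ∉ T → ¬ G.dir a b) ∧ A = W \ T := by
    refine ⟨W \ A, Finset.sdiff_subset, fun a ha b hb hbT hab => ?_,
      (Finset.sdiff_sdiff_eq_self hAW).symm⟩
    rw [Finset.mem_sdiff] at ha hbT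
    exact ha.2 (hA b (by_contra fun h => hbT ⟨hb, h⟩) a ha.1 hab)
  rw [Finset.sdiff_sdiff_eq_self hTW]
  classical
  unfold marginal cFactor
  rw [← measureReal_biUnion_finset]
  · congr 1
    have key : ∀ s : Assign Ω, (∀ a ∉ T, s a = v a) → ∀ u,
        (u ∈ M.agreement (W \ T) s ↔ u ∈ M.agreement (W \ T) v) := by
      intro s hs u
      refine forall₂_congr fun w hw => ?_
      rw [Finset.mem_sdiff] at hw
      rw [M.f_local w s v u u (fun a ha => hs a fun haT =>
        hT a haT w hw.1 hw.2 (hM.1 w a ha)) (fun _ _ => rfl), hs w hw.2]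
    ext u
    simp only [Set.mem_iUnion, Finset.mem_filter, Finset.mem_univ, true_and, exists_prop]
    constructor
    · rintro ⟨s, hs, hu⟩
      exact (key s hs u).1 fun w hw => hu w (Finset.sdiff_subset hw)
    · intro hu
      obtain ⟨s, hs, hsu⟩ := hM.solution_exists T u v
      refine ⟨s, hs, fun w hw => ?_⟩
      by_cases hwT : w ∈ T
      · exact hsu w hwT
      · exact (key s hs u).2 hu w (Finset.mem_sdiff.2 ⟨hw, hwT⟩)
  · intro s hs t ht hne
    simp only [Finset.coe_filter, Finset.mem_univ, true_and, Set.mem_ofPred_eq] at hs ht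
    exact Set.disjoint_left.2 fun u hus hut => hne (hM.solution_unique (T := T)
      (fun a ha => by rw [hs a ha, ht a ha]) (fun w hw => hus w (hTW hw))
      fun w hw => hut w (hTW hw))
  · exact fun s _ => measurableSet_agreement _ _

/-- The natural upper bound `P_x(v) ≤ P(v, x) + 1 - P(x)`. -/
theorem CompatibleWith.cFactor_sdiff_le (hM : M.CompatibleWith G) (X W : Finset V)
    (v : Assign Ω) :
    M.cFactor (W \ X) v ≤ M.cFactor W v + 1 - marginal (W \ X) (M.cFactor W) v := by
  classical
  set I := Finset.univ.filter fun s : Assign Ω => ∀ a ∉ W \ X, s a = v a with hI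
  have hsub (s : Assign Ω) : M.agreement W s ⊆ M.agreement (W \ X) s :=
    fun u hu w hw => hu w (Finset.sdiff_subset hw)
  have hmem {s : Assign Ω} (hs : s ∈ I) : ∀ a ∉ W \ X, s a = v a := by simpa [hI] using hs
  have hsum : marginal (W \ X) (M.cFactor W) v
      = (Measure.pi M.μ).real (⋃ s ∈ I, M.agreement W s) := by
    rw [measureReal_biUnion_finset]
    · rfl
    · exact fun s hs t ht hne => Set.disjoint_left.2 fun u hus hut => hne
        (hM.solution_unique (fun a ha => by rw [hmem hs a ha, hmem ht a ha])
          (hsub s hus) (hsub t hut))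
    · exact fun s _ => measurableSet_agreement _ _
  have hmeas : MeasurableSet (⋃ s ∈ I, M.agreement W s) :=
    Finset.measurableSet_biUnion _ fun s _ => measurableSet_agreement _ _
  -- The union over `s` is the event that `X ∩ W` takes its values in `v` by its own mechanisms. On
  -- it, a unit agreeing with `v` on `W \ X` has `v` as its solution, hence agrees with `v` on all
  -- of `W`.
  have hle : M.agreement (W \ X) v ⊆ M.agreement W v ∪ (⋃ s ∈ I, M.agreement W s)ᶜ := by
    intro u hu
    by_cases h : u ∈ ⋃ s ∈ I, M.agreement W s
    · obtain ⟨s, hs, hus⟩ := Set.mem_iUnion₂.1 h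
      exact .inl (hM.solution_unique (hmem hs) (hsub s hus) hu ▸ hus)
    · exact .inr h
  have := (measureReal_mono (μ := Measure.pi M.μ) hle).trans (measureReal_union_le _ _)
  rw [probReal_compl_eq_one_sub hmeas, ← hsum] at this
  unfold cFactor at this ⊢
  linarith

end SCM

/-! ## Interventional queries -/

namespace SCM

variable {V : Type*} [Fintype V] [DecidableEq V] {Ω : V → Type*} [∀ v, Fintype (Ω v)] {κ : Type*}
  [Fintype κ] {U : κ → Type*} [∀ k, MeasurableSpace (U k)] {M N : SCM Ω U} {G : CausalDiagram V}

/-- The probability of the values of `Y ⊆ W` after the variables off `W` are set to theirs. -/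
noncomputable def query (M : SCM Ω U) (Y W : Finset V) (v : Assign Ω) : ℝ :=
  marginal (W \ Y) (M.cFactor W) v

theorem CompatibleWith.doProb_eq_query (hM : M.CompatibleWith G) (X Y : Finset V)
    (v : Assign Ω) : M.doProb X Y v = M.query Y Xᶜ v := by
  rw [hM.doProb_eq, query]
  congr 1
  ext a
  simp

theorem query_pos {A W : Finset V} (Y : Finset V) (hAW : A ⊆ W)
    (hW : ∀ v, 0 < M.cFactor W v) (v : Assign Ω) : 0 < M.query Y A v :=
  marginal_pos (fun w => (hW w).trans_le (cFactor_anti hAW w)) v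

theorem query_self (W : Finset V) (v : Assign Ω) : M.query W W v = M.cFactor W v := by
  rw [query, Finset.sdiff_self, marginal_empty]

/-- Summing first over `W \ A` replaces `Q[W]` by `Q[A]`. This justifies both the removal of
non-ancestors and the addition of interventions without effect on `Y`. -/
theorem CompatibleWith.query_eq_of_ancestral (hM : M.CompatibleWith G) {Y A W : Finset V}
    (hYA : Y ⊆ A) (hAW : A ⊆ W) (hA : ∀ b ∈ A, ∀ a ∈ W, G.dir a b → a ∈ A) (v : Assign Ω) :
    M.query Y W v = M.query Y A v := by
  have hset : W \ Y = (A \ Y) ∪ (W \ A) := by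
    ext a
    simp only [Finset.mem_sdiff, Finset.mem_union]
    have h1 := @hYA a
    have h2 := @hAW a
    tauto
  have hdisj : Disjoint (A \ Y) (W \ A) :=
    (Finset.disjoint_sdiff).mono_left Finset.sdiff_subset
  rw [query, hset, ← marginal_marginal hdisj, query]
  congr 1
  exact funext (hM.marginal_cFactor hAW hA)

theorem query_congr_model {Y W : Finset V} (hf : ∀ w ∈ W, N.f w = M.f w)
    (hexo : ∀ w ∈ W, ∀ k ∈ M.exo w, N.μ k = M.μ k) (v : Assign Ω) :
    N.query Y W v = M.query Y W v := by
  rw [query, query, funext (cFactor_congr_model hf hexo)]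

end SCM

/-! ## Subgraphs of a causal diagram -/

namespace MixedGraph

section

variable {V : Type*} [Fintype V] [DecidableEq V]

/-- `H` is an induced subgraph of the causal diagram `G`. -/
structure IsInducedIn (H : MixedGraph V) (G : CausalDiagram V) : Prop where
  dir_iff : ∀ a b, H.dir a b ↔ G.dir a b ∧ a ∈ H.verts ∧ b ∈ H.verts
  bi_iff : ∀ a b, H.bi a b ↔ G.bi a b ∧ a ∈ H.verts ∧ b ∈ H.verts

variable {H : MixedGraph V} {G : CausalDiagram V}

theorem IsInducedIn.induce (hH : H.IsInducedIn G) (W : Finset V) : (H.induce W).IsInducedIn G where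
  dir_iff a b := by
    simp only [MixedGraph.induce, hH.dir_iff, Finset.mem_inter]; tauto
  bi_iff a b := by
    simp only [MixedGraph.induce, hH.bi_iff, Finset.mem_inter]; tauto

theorem verts_induce_of_subset {W : Finset V} (h : W ⊆ H.verts) : (H.induce W).verts = W :=
  Finset.inter_eq_right.2 h

theorem verts_del (X : Finset V) : (H.del X).verts = H.verts \ X :=
  verts_induce_of_subset Finset.sdiff_subset

theorem An_subset (Y : Finset V) : H.An Y ⊆ H.verts := by
  classical exact Finset.filter_subset _ _

theorem subset_An {Y : Finset V} (h : Y ⊆ H.verts) : Y ⊆ H.An Y := fun y hy => by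
  simp only [An, Finset.mem_filter]
  exact ⟨h hy, y, hy, .refl⟩

theorem mem_An_of_dir {Y : Finset V} {a b : V} (ha : a ∈ H.verts) (hab : H.dir a b)
    (hb : b ∈ H.An Y) : a ∈ H.An Y := by
  simp only [An, Finset.mem_filter] at hb ⊢
  obtain ⟨-, y, hy, hby⟩ := hb
  exact ⟨ha, y, hy, .head hab hby⟩

theorem IsInducedIn.An_ancestral (hH : H.IsInducedIn G) (Y : Finset V) :
    ∀ b ∈ H.An Y, ∀ a ∈ H.verts, G.dir a b → a ∈ H.An Y := fun b hb a ha hab =>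
  mem_An_of_dir ha ((hH.dir_iff a b).2 ⟨hab, ha, An_subset Y hb⟩) hb

theorem mem_cc {C : Finset V} : C ∈ H.cc ↔ ∃ a ∈ H.verts, C ⊆ H.verts ∧
    ∀ b ∈ H.verts, b ∈ C ↔ Relation.ReflTransGen H.bi a b := by
  classical
  simp only [cc, Finset.mem_image]
  refine exists_congr fun a => and_congr_right fun _ => ?_
  constructor
  · rintro rfl
    exact ⟨Finset.filter_subset _ _, fun b hb => by simp [hb]⟩
  · rintro ⟨h1, h2⟩
    ext b
    simp only [Finset.mem_filter]
    exact ⟨fun h => (h2 b h.1).2 h.2, fun h => ⟨h1 h, (h2 b (h1 h)).1 h⟩⟩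

theorem subset_of_mem_cc {C : Finset V} (hC : C ∈ H.cc) : C ⊆ H.verts :=
  (mem_cc.1 hC).choose_spec.2.1

theorem biUnion_cc : H.cc.biUnion id = H.verts := by
  classical
  ext b
  simp only [Finset.mem_biUnion, id]
  constructor
  · rintro ⟨C, hC, hb⟩
    exact subset_of_mem_cc hC hb
  · intro hb
    refine ⟨H.verts.filter fun c => Relation.ReflTransGen H.bi b c,
      mem_cc.2 ⟨b, hb, Finset.filter_subset _ _, fun c hc => by simp [hc]⟩,
      by simp [hb, Relation.ReflTransGen.refl]⟩

/-- Supplies the absence of bidirected edges between a c-component and the rest of the graph that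
`cFactor_union` requires. -/
theorem IsInducedIn.mem_of_bi (hH : H.IsInducedIn G) {C : Finset V} (hC : C ∈ H.cc) {a b : V}
    (ha : a ∈ C) (hb : b ∈ H.verts) (hab : G.bi a b) : b ∈ C := by
  obtain ⟨c, -, hCs, h⟩ := mem_cc.1 hC
  exact (h b hb).2 (((h a (hCs ha)).1 ha).tail ((hH.bi_iff a b).2 ⟨hab, hCs ha, hb⟩))

theorem IsInducedIn.disjoint_of_mem_cc (hH : H.IsInducedIn G) {A B : Finset V} (hA : A ∈ H.cc)
    (hB : B ∈ H.cc) (hAB : A ≠ B) : Disjoint A B := by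
  have : Std.Symm H.bi := ⟨fun x y hxy => by
    obtain ⟨h1, h2, h3⟩ := (hH.bi_iff x y).1 hxy
    exact (hH.bi_iff y x).2 ⟨G.bi_symm x y h1, h3, h2⟩⟩
  have hsymm {x y : V} (h : Relation.ReflTransGen H.bi x y) : Relation.ReflTransGen H.bi y x :=
    Std.Symm.symm _ _ h
  obtain ⟨a, -, hAs, ha⟩ := mem_cc.1 hA
  obtain ⟨b, -, hBs, hb⟩ := mem_cc.1 hB
  rw [Finset.disjoint_left]
  intro c hcA hcB
  have hac := (ha c (hAs hcA)).1 hcA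
  have hbc := (hb c (hBs hcB)).1 hcB
  refine hAB (Finset.Subset.antisymm (fun d hd => ?_) fun d hd => ?_)
  · exact (hb d (hAs hd)).2 (hbc.trans ((hsymm hac).trans ((ha d (hAs hd)).1 hd)))
  · exact (ha d (hBs hd)).2 (hac.trans ((hsymm hbc).trans ((hb d (hBs hd)).1 hd)))

theorem verts_eq_of_cc_eq_singleton {C : Finset V} (h : H.cc = {C}) : H.verts = C := by
  rw [← biUnion_cc, h, Finset.singleton_biUnion, id]

/-- A selection variable that points to an ancestor of `Y` is not d-separated from `Y`. -/
theorem IsInducedIn.notMem_of_dSep {ι : Type*} (hH : H.IsInducedIn G) {Δ : ι → Finset V} {i : ι}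
    {X Y : Finset V}
    (h : ((H.selectionDiagram Δ).del (obs X)).DSep (sel (Δ i)) (obs Y) ∅) {a : V}
    (ha : a ∈ (H.del X).An Y) : a ∉ Δ i := by
  intro haΔ
  have haX : a ∈ H.verts \ X := by rw [← verts_del]; exact An_subset Y ha
  simp only [An, Finset.mem_filter] at ha
  obtain ⟨-, y, hy, hay⟩ := ha
  set L := (H.selectionDiagram Δ).del (obs X) with hL
  have hmem : ∀ b ∈ H.verts \ X, Sum.inl b ∈ (H.selectionDiagram Δ).verts \ obs X := by
    intro b hb
    simpa [selectionDiagram, obs] using hb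
  -- The path `S_a → a → ⋯ → y` is directed, so it has no collider and is open relative to `∅`. The
  -- second conjunct, that all variables on it are ancestors of its end, keeps the vertices distinct
  -- by acyclicity.
  have key : ∃ l, L.OpenPath ∅ (Sum.inr a) l .fwd (Sum.inl y) ∧
      ∀ c, Sum.inl c ∈ l → Relation.ReflTransGen G.dir c y := by
    clear hy
    induction hay with
    | refl =>
      refine ⟨[Sum.inl a, Sum.inr a], .single ⟨?_, ?_, hmem a haX⟩ (by simp), ?_⟩
      · exact ⟨rfl, (Finset.mem_sdiff.1 haX).1, i, haΔ⟩
      · simp only [selectionDiagram, obs, Finset.mem_sdiff, Finset.inr_mem_disjSum,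
          Finset.mem_filter, Finset.mem_univ, true_and]
        exact ⟨⟨i, haΔ⟩, by simp⟩
      · intro c hc
        simp only [List.mem_cons, Sum.inl.injEq, reduceCtorEq, List.not_mem_nil, or_false] at hc
        exact hc ▸ .refl
    | @tail b c _ hbc ih =>
      obtain ⟨l, hl, hlb⟩ := ih
      have hbc' : G.dir b c := ((hH.dir_iff b c).1 hbc.1).1
      refine ⟨Sum.inl c :: l, .snoc hl ⟨hbc.1, hmem b hbc.2.1, hmem c hbc.2.2⟩ ?_ ?_, ?_⟩
      · exact fun hc => G.acyclic c (Relation.TransGen.tail' (hlb c hc) hbc')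
      · exact ⟨fun h => absurd rfl h.2, fun _ => Finset.notMem_empty _⟩
      · intro d hd
        rcases List.mem_cons.1 hd with h | h
        · exact Sum.inl_injective h ▸ .refl
        · exact (hlb d h).tail hbc'
  obtain ⟨l, hl, -⟩ := key
  exact h _ (by simpa [sel] using haΔ) _ (by simpa [obs] using hy) l .fwd hl

end

end MixedGraph

/-! ## Identification of c-factors -/

/-- A telescoping product along the order `π`, peeled off from its largest element. -/
theorem prod_div_filter_eq {V : Type*} [DecidableEq V] {q : Finset V → ℝ} (hq : ∀ A, 0 < q A)
    (h₀ : q ∅ = 1) {π : V → ℕ} {K : Finset V} (hπ : Set.InjOn π K) :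
    ∏ i ∈ K, q (K.filter fun a => π a ≤ π i) / q (K.filter fun a => π a < π i) = q K := by
  induction K using Finset.induction_on_max_value π with
  | empty => simp [h₀]
  | insert a s ha hmax ih =>
    have hlt : ∀ x ∈ s, π x < π a := fun x hx => (hmax x hx).lt_of_ne fun h =>
      ha (hπ (by simp [hx]) (by simp) h ▸ hx)
    have h1 : (insert a s).filter (fun x => π x ≤ π a) = insert a s :=
      Finset.filter_true_of_mem fun x hx => by
        rcases Finset.mem_insert.1 hx with rfl | hx
        exacts [le_rfl, hmax x hx]
    have h2 : (insert a s).filter (fun x => π x < π a) = s := by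
      rw [Finset.filter_insert, if_neg (lt_irrefl _), Finset.filter_true_of_mem hlt]
    rw [Finset.prod_insert ha, h1, h2]
    have h3 : ∀ i ∈ s, q ((insert a s).filter fun x => π x ≤ π i) /
        q ((insert a s).filter fun x => π x < π i) =
        q (s.filter fun x => π x ≤ π i) / q (s.filter fun x => π x < π i) := by
      intro i hi
      rw [Finset.filter_insert, Finset.filter_insert, if_neg (hlt i hi).not_ge,
        if_neg (hlt i hi).not_gt]
    rw [Finset.prod_congr rfl h3, ih (hπ.mono (by simp)), div_mul_cancel₀ _ (hq s).ne']

section Soundness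

variable {V ι : Type*} [Fintype V] [DecidableEq V] {Ω : V → Type*} [∀ v, Fintype (Ω v)]
  {𝒵 : ι → Finset (Finset V)}

open MixedGraph

/-- Identification of the c-factor of a c-component `K`. -/
theorem Expression.condProd_eq_cFactor {κ : Type*} [Fintype κ] {U : κ → Type*}
    [∀ k, MeasurableSpace (U k)] {M : SCM Ω U} {G : CausalDiagram V} (hM : M.CompatibleWith G)
    {H : MixedGraph V} (hH : H.IsInducedIn G) {π : V → ℕ} (hπ : IsTopologicalOrder H π)
    {K : Finset V} (hK : K ∈ H.cc) {P : Expression Ω 𝒵} {D : ExpData Ω 𝒵}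
    (hP : ∀ v, P D v = M.cFactor H.verts v) (hpos : ∀ v, 0 < M.cFactor H.verts v)
    (v : Assign Ω) : condProd H.verts π P K D v = M.cFactor K v := by
  have hKW := subset_of_mem_cc hK
  have hsub (p : V → Prop) [DecidablePred p] : 0 < M.cFactor (H.verts.filter p) v :=
    (hpos v).trans_le (SCM.cFactor_anti (Finset.filter_subset _ _) v)
  -- Initial segments of a topological order are ancestral. The cutoffs `n = π i + 1` and `n = π i`
  -- give the numerator and the denominator of `cond`.
  have hmarg (n : ℕ) : Expression.sum (H.verts.filter fun a => n ≤ π a) P D v =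
      M.cFactor (H.verts.filter fun a => π a < n) v := by
    rw [sum_apply, funext hP, ← hM.marginal_cFactor (Finset.filter_subset _ _)]
    · congr 1
      ext a
      simp only [Finset.mem_filter, Finset.mem_sdiff]
      constructor
      · exact fun h => ⟨h.1, fun h' => by omega⟩
      · exact fun h => ⟨h.1, by have := h.2; simp only [h.1, true_and] at this; omega⟩
    · intro b hb a ha hab
      rw [Finset.mem_filter] at hb ⊢
      exact ⟨ha, (hπ.2 a b ((hH.dir_iff a b).2 ⟨hab, ha, hb.1⟩)).trans hb.2⟩
  have hsplit (p : V → Prop) [DecidablePred p] : M.cFactor (H.verts.filter p) v =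
      M.cFactor (K.filter p) v * M.cFactor ((H.verts \ K).filter p) v := by
    rw [← SCM.cFactor_union hM]
    · rw [← Finset.filter_union, Finset.union_sdiff_of_subset hKW]
    · exact Finset.disjoint_filter_filter Finset.disjoint_sdiff
    · intro a ha b hb hab
      rw [Finset.mem_filter, Finset.mem_sdiff] at hb
      exact hb.1.2 (hH.mem_of_bi hK (Finset.mem_filter.1 ha).1 hb.1.1 hab)
  have hcond : ∀ i ∈ K, cond H.verts π P i D v =
      M.cFactor (K.filter fun a => π a ≤ π i) v / M.cFactor (K.filter fun a => π a < π i) v := by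
    intro i hi
    -- As `i` lies in `K`, both segments have the same part outside `K`, whose c-factor cancels in
    -- the quotient.
    have hrest : (H.verts \ K).filter (fun a => π a < π i + 1) =
        (H.verts \ K).filter fun a => π a < π i := by
      refine Finset.filter_congr fun a ha => ?_
      rw [Finset.mem_sdiff] at ha
      have : π a ≠ π i := fun h => ha.2 (hπ.1 ha.1 (hKW hi) h ▸ hi)
      omega
    have hne : M.cFactor ((H.verts \ K).filter fun a => π a < π i) v ≠ 0 :=
      (right_ne_zero_of_mul (hsplit (fun a => π a < π i) ▸ (hsub _).ne'))
    have h1 := hmarg (π i + 1)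
    simp only [Nat.add_one_le_iff] at h1
    rw [cond, h1, hmarg, hsplit, hsplit, hrest, mul_div_mul_right _ _ hne]
    simp only [Nat.lt_add_one_iff]
  have hpos' (A : Finset V) : 0 < M.cFactor (A ∩ H.verts) v :=
    (hpos v).trans_le (SCM.cFactor_anti Finset.inter_subset_right v)
  rw [condProd, Finset.prod_congr rfl hcond]
  -- Intersecting with `H.verts` makes the set function positive on every set, as the telescoping
  -- lemma demands.
  have := prod_div_filter_eq (q := fun A => M.cFactor (A ∩ H.verts) v) hpos'
    (by simp [SCM.cFactor_empty]) (hπ.1.mono (Finset.coe_subset.2 hKW))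
  have hint (p : V → Prop) [DecidablePred p] : K.filter p ∩ H.verts = K.filter p :=
    Finset.inter_eq_left.2 ((Finset.filter_subset _ _).trans hKW)
  simpa only [hint, Finset.inter_eq_left.2 hKW] using this

/-- Since `W` contains its parents, `W \ Z` is ancestral in `Zᶜ` and its mechanisms read no value
outside `W`; so the arbitrary `z` drops out. -/
theorem ModelCollection.experiment_eq_cFactor {𝓜 : ModelCollection Ω ι} {G : CausalDiagram V}
    {i : ι} (hM : (𝓜.source i).CompatibleWith G) (Z : {Z : Finset V // Z ∈ 𝒵 i}) {W : Finset V}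
    (hW : ∀ b ∈ W, ∀ a, G.dir a b → a ∈ W) (z v : Assign Ω) :
    Expression.experiment i Z W z (𝓜.data 𝒵) v = (𝓜.source i).cFactor (W \ Z.1) v := by
  have hdata : 𝓜.data 𝒵 i Z = (𝓜.source i).cFactor Z.1ᶜ := by
    funext w
    rw [ModelCollection.data, hM.doProb_eq, Finset.union_compl, Finset.compl_univ, marginal_empty]
  have hset : (W ∪ Z.1)ᶜ = Z.1ᶜ \ (W \ Z.1) := by
    ext a
    simp only [Finset.mem_compl, Finset.mem_union, Finset.mem_sdiff]
    tauto
  rw [Expression.experiment, Expression.sum_apply, hdata, hset, hM.marginal_cFactor]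
  · refine SCM.cFactor_congr_assign hM (fun w hw => ?_) fun w hw a ha => ?_
    · simp [mergeOn, (Finset.mem_sdiff.1 hw).1]
    · simp [mergeOn, hW w (Finset.mem_sdiff.1 hw).1 a ha]
  · intro a ha
    simpa using (Finset.mem_sdiff.1 ha).2
  · intro b hb a ha hab
    rw [Finset.mem_sdiff] at hb ⊢
    exact ⟨hW b hb.1 a hab, by simpa using ha⟩

/-! ## Soundness -/

/-- `e` is a bound for `q` of the given type; lower bounds are required to be positive. -/
def BoundType.IsBound : BoundType → ℝ → ℝ → Prop
  | .lower, e, q => 0 < e ∧ e ≤ q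
  | .upper, e, q => q ≤ e

theorem BoundType.IsBound.of_eq {t : BoundType} {e q : ℝ} (h : e = q) (hq : 0 < q) :
    t.IsBound e q := by
  cases t
  · exact ⟨h ▸ hq, h.le⟩
  · exact h.ge

/-- The invariant of the recursion is that `P` is the positive c-factor of all current vertices.
Every branch is exact except `natural`. -/
theorem PaID.isBound {t : BoundType} {X Y : Finset V} {P e : Expression Ω 𝒵} {H : MixedGraph V}
    (h : PaID t Y X P H e) {κ : Type*} [Fintype κ] {U : κ → Type*} [∀ k, MeasurableSpace (U k)]
    {M : SCM Ω U} {G : CausalDiagram V} (hM : M.CompatibleWith G) {D : ExpData Ω 𝒵}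
    (hH : H.IsInducedIn G) (hX : X ⊆ H.verts) (hY : Y ⊆ H.verts) (hXY : Disjoint X Y)
    (hP : ∀ v, P D v = M.cFactor H.verts v) (hpos : ∀ v, 0 < M.cFactor H.verts v)
    (v : Assign Ω) : t.IsBound (e D v) (M.query Y (H.verts \ X) v) := by
  induction h with
  | noIntervention hX₀ =>
    refine .of_eq ?_ (SCM.query_pos _ Finset.sdiff_subset hpos v)
    rw [hX₀, Finset.sdiff_empty, Expression.sum_apply, funext hP, SCM.query]
  | @ancestors X P H e _ _ _ ih =>
    have hA := An_subset (H := H) Y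
    have hYA := subset_An hY
    rw [verts_induce_of_subset hA] at ih
    have hq : M.query Y (H.verts \ X) v = M.query Y (H.An Y \ (X ∩ H.An Y)) v := by
      refine hM.query_eq_of_ancestral ?_ ?_ ?_ v
      · intro y hy
        simp [hYA hy, Finset.disjoint_right.1 hXY hy]
      · intro a ha
        simp only [Finset.mem_sdiff, Finset.mem_inter, not_and] at ha ⊢
        exact ⟨hA ha.1, fun h => ha.2 h ha.1⟩
      · intro b hb a ha hab
        simp only [Finset.mem_sdiff, Finset.mem_inter, not_and] at ha hb ⊢
        exact ⟨hH.An_ancestral Y b hb.1 a ha.1 hab, fun h => absurd h ha.2⟩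
    rw [hq]
    refine ih (hH.induce _) Finset.inter_subset_right hYA
      (hXY.mono_left Finset.inter_subset_left) (fun w => ?_)
      (fun w => (hpos w).trans_le (SCM.cFactor_anti hA w))
    rw [Expression.sum_apply, funext hP]
    exact hM.marginal_cFactor hA (hH.An_ancestral Y) w
  | @natural X P H _ _ _ =>
    have hset : H.verts \ (Y ∪ X) = (H.verts \ X) \ Y := by
      rw [Finset.union_comm, sdiff_sdiff_left, Finset.sup_eq_union]
    have hP' : P D = M.cFactor H.verts := funext hP
    cases t with
    | lower =>
      simp only [naturalBound, Expression.sum_apply, hP', hset]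
      exact ⟨marginal_pos hpos v, marginal_mono (SCM.cFactor_anti Finset.sdiff_subset) v⟩
    | upper =>
      simp only [naturalBound, Expression.sum_apply, hP', hset]
      exact marginal_mono (hM.cFactor_sdiff_le X H.verts) v
  | @component X P H C π _ _ _ hC hπ hCcc =>
    have hCX : H.verts \ X = C := by rw [← verts_del]; exact verts_eq_of_cc_eq_singleton hC
    refine .of_eq ?_ (SCM.query_pos _ Finset.sdiff_subset hpos v)
    rw [hCX, Expression.sum_apply, SCM.query,
      funext (Expression.condProd_eq_cFactor hM hH hπ hCcc hP hpos)]
  | @subcomponent X P H e C K π _ _ _ hC hπ hCK hK _ ih =>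
    have hKW := subset_of_mem_cc hK
    have hCX : H.verts \ X = C := by rw [← verts_del]; exact verts_eq_of_cc_eq_singleton hC
    -- The vertices not intervened on form `C ⊂ K`, so the rest of `K` lies in `X`.
    have hKX : H.verts \ X = K \ (X ∩ K) := by
      refine Finset.Subset.antisymm (fun a ha => ?_) (fun a ha => ?_)
      · simp only [Finset.mem_sdiff, Finset.mem_inter, not_and]
        exact ⟨hCK.1 (hCX ▸ ha), fun h => absurd h (Finset.mem_sdiff.1 ha).2⟩
      · simp only [Finset.mem_sdiff, Finset.mem_inter, not_and] at ha ⊢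
        exact ⟨hKW ha.1, fun h => ha.2 h ha.1⟩
    rw [verts_induce_of_subset hKW] at ih
    rw [hKX]
    refine ih (hH.induce _) Finset.inter_subset_right (fun y hy => hCK.1 ?_)
      (hXY.mono_left Finset.inter_subset_left)
      (Expression.condProd_eq_cFactor hM hH hπ hK hP hpos)
      fun w => (hpos w).trans_le (SCM.cFactor_anti hKW w)
    exact hCX ▸ Finset.mem_sdiff.2 ⟨hY hy, Finset.disjoint_right.1 hXY hy⟩

/-- The current graph stays closed under parents in `G`, so experiments restrict to it, and `Δ'`
keeps every discrepancy among its vertices. -/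
theorem PaTR.isBound {t : BoundType} {X Y : Finset V} {H : MixedGraph V} {Δ' : ι → Finset V}
    {e : Expression Ω 𝒵} (h : PaTR t Y X H Δ' e) {G : CausalDiagram V} {Δ : ι → Finset V}
    {𝓜 : ModelCollection Ω ι} (hM : 𝓜.Induces G Δ) (hpos : 𝓜.Positive 𝒵)
    (hH : H.IsInducedIn G) (hanc : ∀ b ∈ H.verts, ∀ a, G.dir a b → a ∈ H.verts)
    (hΔ : ∀ i, ∀ a ∈ H.verts, a ∈ Δ i → a ∈ Δ' i)
    (hX : X ⊆ H.verts) (hY : Y ⊆ H.verts) (hXY : Disjoint X Y) (v : Assign Ω) :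
    t.IsBound (e (𝓜.data 𝒵) v) (𝓜.target.query Y (H.verts \ X) v) := by
  obtain ⟨hT, hS, hST⟩ := hM
  have hpos' (W : Finset V) (hW : ∀ b ∈ W, ∀ a, G.dir a b → a ∈ W) (i : ι)
      (Z : {Z : Finset V // Z ∈ 𝒵 i}) (w : Assign Ω) :
      0 < (𝓜.source i).cFactor (W \ Z.1) w := by
    rw [← ModelCollection.experiment_eq_cFactor (hS i) Z hW w]
    exact marginal_pos (hpos i Z) _
  have htransport (i : ι) (Y W : Finset V) (hW : ∀ a ∈ W, a ∉ Δ i) (w : Assign Ω) :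
      (𝓜.source i).query Y W w = 𝓜.target.query Y W w :=
    SCM.query_congr_model (fun a ha => (hST i a (hW a ha)).1)
      (fun a ha => (hST i a (hW a ha)).2.2) w
  induction h generalizing v with
  | @direct Y X H Δ' i Z z hXZ hsep =>
    have hsub := An_subset (H := H.del X) Y
    have hH' : (H.del X).IsInducedIn G := hH.induce _
    have hYA : Y ⊆ (H.del X).An Y := subset_An fun y hy => by
      rw [verts_del]
      exact Finset.mem_sdiff.2 ⟨hY hy, Finset.disjoint_right.1 hXY hy⟩
    have hclosed := hH'.An_ancestral Y
    rw [verts_del] at hsub hclosed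
    have hset : H.verts \ (Y ∪ X) = (H.verts \ X) \ Y := by
      rw [Finset.union_comm, sdiff_sdiff_left, Finset.sup_eq_union]
    have hXZ' : H.verts \ Z.1 = H.verts \ X := by
      rw [hXZ, Finset.inter_comm, Finset.sdiff_inter_self_left]
    have hexp : Expression.experiment i Z H.verts z (𝓜.data 𝒵) =
        (𝓜.source i).cFactor (H.verts \ X) := by
      funext w
      rw [ModelCollection.experiment_eq_cFactor (hS i) Z hanc, hXZ']
    -- Only ancestors of `Y` in `H.del X` matter to either query, and d-separation keeps them free
    -- of discrepancies.
    have heq : (𝓜.source i).query Y (H.verts \ X) v = 𝓜.target.query Y (H.verts \ X) v := by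
      rw [(hS i).query_eq_of_ancestral hYA hsub hclosed, hT.query_eq_of_ancestral hYA hsub hclosed]
      exact htransport i _ _ (fun a ha haΔ => hH.notMem_of_dSep hsep ha
        (hΔ i a (Finset.mem_sdiff.1 (hsub ha)).1 haΔ)) v
    rw [← heq, hset, Expression.sum_apply, hexp]
    refine .of_eq rfl (SCM.query_pos _ le_rfl (fun w => ?_) v)
    rw [← hXZ']
    exact hpos' _ hanc i Z w
  | @nonAncestors Y X H Δ' e R hR _ _ ih =>
    have hA := An_subset (H := H) Y
    have hYA := subset_An hY
    have hverts : (H.del R).verts = H.An Y := by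
      rw [verts_del, hR, Finset.sdiff_sdiff_eq_self hA]
    rw [hverts] at ih
    have hXR : X \ R ⊆ H.An Y := by
      intro a ha
      rw [hR, Finset.mem_sdiff, Finset.mem_sdiff] at ha
      exact by_contra fun h => ha.2 ⟨hX ha.1, h⟩
    have hq : 𝓜.target.query Y (H.verts \ X) v = 𝓜.target.query Y (H.An Y \ (X \ R)) v := by
      refine hT.query_eq_of_ancestral ?_ ?_ ?_ v
      · intro y hy
        simp [hYA hy, Finset.disjoint_right.1 hXY hy]
      · intro a ha
        simp only [hR, Finset.mem_sdiff, not_and, not_not] at ha ⊢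
        exact ⟨hA ha.1, fun h => ha.2 h (fun _ => ha.1)⟩
      · intro b hb a ha hab
        simp only [Finset.mem_sdiff, not_and] at ha hb ⊢
        exact ⟨hH.An_ancestral Y b hb.1 a ha.1 hab, fun h => absurd h ha.2⟩
    rw [hq]
    refine ih (hH.induce _) (fun b hb a hab => ?_) (fun i a ha haΔ => ?_) hXR hYA
      (hXY.mono_left Finset.sdiff_subset) v
    · exact hH.An_ancestral Y b hb a (hanc b (hA hb) a hab) hab
    · rw [Finset.mem_sdiff, hR]
      exact ⟨hΔ i a (hA ha) haΔ, fun h => (Finset.mem_sdiff.1 h).2 ha⟩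
  | @extend Y X H Δ' e R w _ hR _ _ ih =>
    have hYC : Y ⊆ (H.cutIncoming X).An Y := subset_An hY
    have hRY : Disjoint R Y := by
      rw [hR]
      exact Finset.sdiff_disjoint.mono_right hYC
    have hRW : R ⊆ H.verts \ X := hR ▸ Finset.sdiff_subset
    have hq : 𝓜.target.query Y (H.verts \ X) v =
        𝓜.target.query Y (H.verts \ (X ∪ R)) (mergeOn R w v) := by
      -- No edge leads from `R` to an unfixed vertex outside `R`, so `R` sums out; the resulting
      -- query does not change when `R` is reset to `w`.
      rw [← hT.query_eq_of_ancestral (W := H.verts \ X) (A := H.verts \ (X ∪ R))]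
      · refine marginal_congr_assign _ fun a ha => ?_
        have : a ∉ R := fun h => ha (Finset.mem_sdiff.2 ⟨hRW h, Finset.disjoint_left.1 hRY h⟩)
        simp [mergeOn, this]
      · intro y hy
        simp [hY hy, Finset.disjoint_right.1 hXY hy, Finset.disjoint_right.1 hRY hy]
      · exact Finset.sdiff_subset_sdiff le_rfl Finset.subset_union_left
      · intro b hb a ha hab
        simp only [Finset.mem_sdiff, Finset.mem_union, not_or] at ha hb ⊢
        refine ⟨ha.1, ha.2, fun haR => ?_⟩
        have hbA : b ∈ (H.cutIncoming X).An Y := by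
          by_contra hbA
          exact hb.2.2 (hR ▸ Finset.mem_sdiff.2 ⟨Finset.mem_sdiff.2 ⟨hb.1, hb.2.1⟩, hbA⟩)
        rw [hR, Finset.mem_sdiff] at haR
        exact haR.2 (mem_An_of_dir ha.1 ⟨(hH.dir_iff a b).2 ⟨hab, ha.1, hb.1⟩, hb.2.1⟩ hbA)
    rw [hq]
    exact ih hH hanc hΔ (Finset.union_subset hX (hRW.trans Finset.sdiff_subset)) hY
      (Finset.disjoint_union_left.2 ⟨hXY, hRY⟩) _
  | @factorize Y X H Δ' E _ _ _ _ ih =>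
    have hset : H.verts \ (Y ∪ X) = (H.verts \ X) \ Y := by
      rw [Finset.union_comm, sdiff_sdiff_left, Finset.sup_eq_union]
    have hH' : (H.del X).IsInducedIn G := hH.induce _
    have hprod (w : Assign Ω) : 𝓜.target.cFactor (H.verts \ X) w =
        ∏ C ∈ (H.del X).cc, 𝓜.target.cFactor C w := by
      rw [← verts_del, ← biUnion_cc]
      refine SCM.cFactor_biUnion hT _ (fun A hA B hB => hH'.disjoint_of_mem_cc hA hB) ?_ w
      intro A hA B hB hAB a ha b hb hab
      exact Finset.disjoint_left.1 (hH'.disjoint_of_mem_cc hA hB hAB)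
        (hH'.mem_of_bi hA ha (subset_of_mem_cc hB hb) hab) hb
    have hfac (C : Finset V) (hC : C ∈ (H.del X).cc) (w : Assign Ω) :
        t.IsBound (E C (𝓜.data 𝒵) w) (𝓜.target.cFactor C w) := by
      have hCW : C ⊆ H.verts :=
        (subset_of_mem_cc hC).trans (verts_del (H := H) X ▸ Finset.sdiff_subset)
      have := ih C hC hH hanc hΔ Finset.sdiff_subset hCW Finset.sdiff_disjoint w
      rwa [Finset.sdiff_sdiff_eq_self hCW, SCM.query_self] at this
    rw [SCM.query, hset, Expression.sum_apply, funext hprod]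
    -- Monotonicity of the product needs nonnegative smaller factors: the lower bounds are positive,
    -- and for upper bounds the smaller factors are the c-factors themselves.
    cases t with
    | lower =>
      exact ⟨marginal_pos (fun w => Finset.prod_pos fun C hC => (hfac C hC w).1) v,
        marginal_mono (fun w => Finset.prod_le_prod (fun C hC => (hfac C hC w).1.le)
          fun C hC => (hfac C hC w).2) v⟩
    | upper =>
      exact marginal_mono (fun w => Finset.prod_le_prod (fun C _ => SCM.cFactor_nonneg C w)
        fun C hC => hfac C hC w) v
  | @identify Y X H Δ' e i Z z _ _ _ hΔi hZX hID =>
    have hverts : (H.del (Z.1 ∩ X)).verts = H.verts \ Z.1 := by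
      rw [verts_del]
      ext a
      simp only [Finset.mem_sdiff, Finset.mem_inter, not_and]
      exact ⟨fun h => ⟨h.1, fun hZ => h.2 hZ (hZX (Finset.mem_inter.2 ⟨hZ, h.1⟩))⟩,
        fun h => ⟨h.1, fun hZ => absurd hZ h.2⟩⟩
    have hset : (H.verts \ Z.1) \ (X \ Z.1) = H.verts \ X := by
      ext a
      simp only [Finset.mem_sdiff, not_and, not_not]
      exact ⟨fun h => ⟨h.1.1, fun hX => h.1.2 (h.2 hX)⟩, fun h =>
        ⟨⟨h.1, fun hZ => h.2 (hZX (Finset.mem_inter.2 ⟨hZ, h.1⟩))⟩, fun hX => absurd hX h.2⟩⟩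
    have := hID.isBound (hS i) (hH.induce _) (D := 𝓜.data 𝒵)
      (by rw [hverts]; exact Finset.sdiff_subset_sdiff hX le_rfl)
      (fun y hy => by
        rw [hverts]
        exact Finset.mem_sdiff.2 ⟨hY hy, fun hZ => Finset.disjoint_right.1 hXY hy
          (hZX (Finset.mem_inter.2 ⟨hZ, hY hy⟩))⟩)
      (hXY.mono_left Finset.sdiff_subset)
      (fun w => by
        rw [hverts]
        exact ModelCollection.experiment_eq_cFactor (hS i) Z hanc z w)
      (fun w => by
        rw [hverts]
        exact hpos' _ hanc i Z w) v
    rw [hverts, hset] at this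
    -- `PaID` bounds the query in the source; its c-factor involves only `H.verts \ X`, where source
    -- and target do not differ.
    rwa [htransport] at this
    intro a ha haΔ
    have : a ∈ Δ' i ∩ (H.verts \ X) :=
      Finset.mem_inter.2 ⟨hΔ i a (Finset.mem_sdiff.1 ha).1 haΔ, ha⟩
    simp [hΔi] at this

theorem PaTR.isBound_doProb {t : BoundType} {X Y : Finset V} {G : CausalDiagram V}
    {Δ : ι → Finset V} {e : Expression Ω 𝒵} (h : PaTR t Y X G.toMixedGraph Δ e)
    (hXY : Disjoint X Y) {𝓜 : ModelCollection Ω ι} (hM : 𝓜.Induces G Δ) (hpos : 𝓜.Positive 𝒵)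
    (v : Assign Ω) : t.IsBound (e (𝓜.data 𝒵) v) (𝓜.target.doProb X Y v) := by
  have hverts := G.verts_eq
  have := h.isBound hM hpos ⟨by simp [hverts], by simp [hverts]⟩ (by simp [hverts])
    (fun _ _ _ h => h) (by simp [hverts]) (by simp [hverts]) hXY v
  rwa [hverts, ← Finset.compl_eq_univ_sdiff, ← hM.1.doProb_eq_query] at this

end Soundness

theorem SCM.doProb_le_one {V : Type*} [Fintype V] {Ω : V → Type*} {κ : Type*} [Fintype κ]
    {U : κ → Type*} [∀ k, MeasurableSpace (U k)] (M : SCM Ω U) (X Y : Finset V) (v : Assign Ω) :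
    M.doProb X Y v ≤ 1 :=
  MeasureTheory.measureReal_le_one

theorem mainTheorem7 {V : Type uV} [Fintype V] [DecidableEq V]
    {Ω : V → Type uΩ} [∀ v, Fintype (Ω v)] {ι : Type uι}
    (G : CausalDiagram V) (Δ : ι → Finset V) (𝒵 : ι → Finset (Finset V))
    (X Y : Finset V) (hXY : Disjoint X Y) :
    (∀ e : Expression Ω 𝒵, PaTR BoundType.lower Y X G.toMixedGraph Δ e →
      ∀ 𝓜 : ModelCollection.{uV, uΩ, uι, uκ, uU} Ω ι, 𝓜.Induces G Δ → 𝓜.Positive 𝒵 →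
        ∀ v : Assign Ω, e (𝓜.data 𝒵) v ≤ 𝓜.target.doProb X Y v) ∧
    (∀ e : Expression Ω 𝒵, PaTR BoundType.upper Y X G.toMixedGraph Δ e →
      ∀ 𝓜 : ModelCollection.{uV, uΩ, uι, uκ, uU} Ω ι, 𝓜.Induces G Δ → 𝓜.Positive 𝒵 →
        ∀ v : Assign Ω, 𝓜.target.doProb X Y v ≤ e (𝓜.data 𝒵) v) ∧
    (∀ l u : Expression Ω 𝒵, PaTR BoundType.lower Y X G.toMixedGraph Δ l →
      PaTR BoundType.upper Y X G.toMixedGraph Δ u →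
        ∀ v : Assign Ω, IsPartiallyTransportableBound.{uV, uΩ, uι, uκ, uU} G Δ 𝒵 X Y v
          (fun D => l D v) (fun D => min 1 (u D v))) := by
  refine ⟨fun e he 𝓜 hM hpos v => (he.isBound_doProb hXY hM hpos v).2,
    fun e he 𝓜 hM hpos v => he.isBound_doProb hXY hM hpos v, ?_⟩
  intro l u hl hu v 𝓜 hM hpos
  obtain ⟨hl₀, hl₁⟩ := hl.isBound_doProb hXY hM hpos v
  have hu₁ : 𝓜.target.doProb X Y v ≤ u (𝓜.data 𝒵) v := hu.isBound_doProb hXY hM hpos v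
  refine ⟨⟨fun r hr => ⟨hl₀.le.trans hr.1, hr.2.trans (min_le_left _ _)⟩, fun h => ?_⟩,
    hl₁, le_min (SCM.doProb_le_one _ _ _ _) hu₁⟩
  -- The interval omits `0`, because its lower end is positive.
  exact hl₀.not_ge (h ⟨le_rfl, zero_le_one⟩).1
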